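/- Let $(V,\otimes,k)$ be a commutative quantale with internal hom $[-,=]$. A $V$-category is a set $X$ with $a:X\times X\to V$ such that $k\le a(x,x)$ and $a(x,y)\otimes a(y,z)\le a(x,z)$; write $x\le y$ for $k\le a(x,y)$. An $(L,V)$-category is a set $X$ with $a:LX\times X\to V$, where $LX$ is the set of finite lists in $X$ (including the empty one), such that $k\le a((x),x)$ and $a(\underline x_1,y_1)\otimes\dots\otimes a(\underline x_n,y_n)\otimes a((y_1,\dots,y_n),z)\le a((\underline x_1;\dots;\underline x_n),z)$. A map $f:(X,a)\to(Y,b)$ is an $(L,V)$-functor if $a(\underline x,y)\le b(Lf(\underline x),f(y))$ for all $\underline x,y$, and is fully faithful if equality always holds. A $V$-quantum B-algebra is a promonoidal $V$-category $(X,a,P,J)$ (a monoid in the monoidal category of $V$-distributors) with operations $\rhd,\lhd$ and an element $u_X$ such that $P(x,z,y)=a(z,x\lhd y)$, $P(z,x,y)=a(z,x\rhd y)$, $J(x)=a(u_X,x)$. Its morphisms are the $V$-functors $f$ with $f(x\rhd y)\le f(x)\rhd f(y)$, $f(x\lhd y)\le f(x)\lhd f(y)$ and $u_Y\le f(u_X)$.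 It is regarded as an $(L,V)$-category via $a((x_1,\dots,x_n),y)=a(x_1,x_2\rhd(\cdots(x_n\rhd y)))$ and $a((),y)=a(u_X,y)$. A $V$-quantale $(Q,\ast,u_Q)$ is a separated cocomplete monoidal $V$-category whose multiplication is cocontinuous in each variable. It is regarded as a $V$-quantum B-algebra via the right adjoints $y\rhd(-)$ of $(-)\ast y$ and $x\lhd(-)$ of $x\ast(-)$, and as an $(L,V)$-category via $Q((q_1,\dots,q_n),w)=Q(q_1\ast\dots\ast q_n,w)$. A map $i:X\to Q$ from a $V$-quantum B-algebra to a $V$-quantale is *dense* if it is a fully faithful $(L,V)$-functor and every $q\in Q$ is both the $V$-limit of $i$ weighted by $i^{*}\cdot q_{*}$ (whose value at $x$ is $Q(q,i(x))$) and the $(L,V)$-colimit of $i$ weighted by $q^{\circledast}\circ i_{\circledast}$ (whose value at $(x_1,\dots,x_n)$ is $Q(i(x_1)\ast\dots\ast i(x_n),q)$). A map $e:X\to Y$ is *essential* in a category of $(L,V)$-categories if it is fully faithful and, for every morphism $f:Y\to Z$ of that category, if $fe$ is fully faithful then $f$ is fully faithful. **Theorem.** Let $i:X\to Q$ be a morphism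 of $V$-quantum B-algebras from a $V$-quantum B-algebra $X$ to a $V$-quantale $Q$. Then $i$ is dense if and only if it is essential in the category of $V$-quantum B-algebras; and also $i$ is dense if and only if it is essential in the category of all $(L,V)$-categories. -/

import Mathlib

universe v u

namespace QEnr

open Quantale

/-! ### `V`-relations, `V`-categories, `V`-functors, distributors -/

/-- A `V`-relation from `X` to `Y`. -/
abbrev VRel (V : Type*) (X Y : Type*) := X → Y → V

/-- Composition `s · r` of `V`-relations (first `r`, then `s`). -/
def VRel.comp {V : Type*} [CommMonoid V] [CompleteLattice V] {X Y Z : Type*}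
    (s : VRel V Y Z) (r : VRel V X Y) : VRel V X Z :=
  fun x z => ⨆ y, r x y * s y z

/-- A `V`-category structure on the set `X`. -/
structure VCat (V : Type v) [CommMonoid V] [CompleteLattice V] (X : Type u) where
  hom : VRel V X X
  id_le : ∀ x, 1 ≤ hom x x
  comp_le : ∀ x y z, hom x y * hom y z ≤ hom x z

section VCat

variable {V : Type v} [CommMonoid V] [CompleteLattice V]
variable {X Y Z : Type*}

/-- The underlying (pre)order of a `V`-category. -/
def VCat.le (A : VCat V X) (x y : X) : Prop := 1 ≤ A.hom x y

/-- Separated `V`-categories: the underlying preorder is antisymmetric. -/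
def VCat.Separated (A : VCat V X) : Prop := ∀ x y, A.le x y → A.le y x → x = y

/-- The one-point `V`-category `K = (1, k)`. -/
def VCat.point (V : Type v) [CommMonoid V] [CompleteLattice V] : VCat V Unit where
  hom _ _ := 1
  id_le _ := le_rfl
  comp_le _ _ _ := by simp

def IsVFunctor (A : VCat V X) (B : VCat V Y) (f : X → Y) : Prop :=
  ∀ x y, A.hom x y ≤ B.hom (f x) (f y)

/-- `j : (X, a) ⇸ (Y, b)` is a distributor: `j · a ≤ j` and `b · j ≤ j`. -/
def IsVDistributor (A : VCat V X) (B : VCat V Y) (j : VRel V X Y) : Prop :=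
  VRel.comp j A.hom ≤ j ∧ VRel.comp B.hom j ≤ j

/-- `f_*(x, y) = b(f x, y)`. -/
def VCat.lowerStar (B : VCat V Y) (f : X → Y) : VRel V X Y := fun x y => B.hom (f x) y

/-- `f^*(y, x) = b(y, f x)`. -/
def VCat.upperStar (B : VCat V Y) (f : X → Y) : VRel V Y X := fun y x => B.hom y (f x)

/-- The `V`-functor `g : (Z, c) → (Y, b)` is the colimit of `f : X → Y` weighted by
`j : X ⇸ Z`. The internal hom of `V` is `⇨ₗ`. -/
def IsVColim (C : VCat V Z) (B : VCat V Y) (j : VRel V X Z) (f : X → Y) (g : Z → Y) : Prop :=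
  IsVFunctor C B g ∧
    ∀ z y, B.lowerStar g z y = ⨅ x, (j x z ⇨ₗ B.lowerStar f x y)

/-- The `V`-functor `h : (Z, c) → (Y, b)` is the limit of `f : X → Y` weighted by
`l : Z ⇸ X`. -/
def IsVLim (C : VCat V Z) (B : VCat V Y) (l : VRel V Z X) (f : X → Y) (h : Z → Y) : Prop :=
  IsVFunctor C B h ∧
    ∀ y z, B.upperStar h y z = ⨅ x, (l z x ⇨ₗ B.upperStar f y x)

/-- All (small) weighted colimits exist. -/
def VCat.Cocomplete {Y : Type u} (B : VCat V Y) : Prop :=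
  ∀ (X Z : Type u) (A : VCat V X) (C : VCat V Z) (f : X → Y) (j : VRel V X Z),
    IsVFunctor A B f → IsVDistributor A C j → ∃ g : Z → Y, IsVColim C B j f g

/-- `F` is a `V`-functor that preserves all (small) weighted colimits that exist. -/
def IsCocontinuous {Y Y' : Type u} (B : VCat V Y) (B' : VCat V Y') (F : Y → Y') : Prop :=
  IsVFunctor B B' F ∧
  ∀ (X Z : Type u) (A : VCat V X) (C : VCat V Z) (f : X → Y) (j : VRel V X Z) (g : Z → Y),
    IsVFunctor A B f → IsVDistributor A C j → IsVColim C B j f g →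
      IsVColim C B' j (F ∘ f) (F ∘ g)

end VCat

/-! ### `(L,V)`-categories, `L` the list monad -/

section List

variable {V : Type v} [CommMonoid V] [CompleteLattice V]
variable {X Y Z : Type*}

/-- The extension of the list functor to `V`-relations. -/
def VRel.list (r : VRel V X Y) : VRel V (List X) (List Y)
  | [], [] => 1
  | x :: xs, y :: ys => r x y * VRel.list r xs ys
  | _, _ => ⊥

/-- `r̂ = L r · m°` for an `(L,V)`-relation `r`, where `m` is the multiplication
(concatenation) of the list monad. -/
def VRel.hat (r : VRel V (List X) Y) : VRel V (List X) (List Y) :=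
  fun xs ys => ⨆ (xss : List (List X)) (_ : xss.flatten = xs), VRel.list r xss ys

/-- Kleisli composition `s ∘ r = s · L r · m°` of `(L,V)`-relations. -/
def VRel.kcomp (s : VRel V (List Y) Z) (r : VRel V (List X) Y) : VRel V (List X) Z :=
  VRel.comp s (VRel.hat r)

/-- An `(L,V)`-category structure on `X`: `e° ≤ a` and `a ∘ a ≤ a`. -/
structure LVCat (V : Type v) [CommMonoid V] [CompleteLattice V] (X : Type u) where
  hom : VRel V (List X) X
  id_le : ∀ x, 1 ≤ hom [x] x
  comp_le : VRel.kcomp hom hom ≤ hom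

def IsLVFunctor (A : LVCat V X) (B : LVCat V Y) (f : X → Y) : Prop :=
  ∀ xs x, A.hom xs x ≤ B.hom (xs.map f) (f x)

/-- Fully faithful `(L,V)`-functors; they form the class `J` of embeddings. -/
def IsLVFullyFaithful (A : LVCat V X) (B : LVCat V Y) (f : X → Y) : Prop :=
  ∀ xs x, A.hom xs x = B.hom (xs.map f) (f x)

/-- `f_⊛(xs, y) = b(L f xs, y)`. -/
def LVCat.lowerStar (B : LVCat V Y) (f : X → Y) : VRel V (List X) Y :=
  fun xs y => B.hom (xs.map f) y

/-- `f^⊛(ys, x) = b(ys, f x)`. -/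
def LVCat.upperStar (B : LVCat V Y) (f : X → Y) : VRel V (List Y) X :=
  fun ys x => B.hom ys (f x)

/-- The `(L,V)`-functor `g : (Z, c) → (Y, b)` is the `(L,V)`-colimit of `f : X → Y` weighted by
the `(L,V)`-relation `j` from `X` to `Z`. -/
def IsLVColim (C : LVCat V Z) (B : LVCat V Y) (j : VRel V (List X) Z) (f : X → Y)
    (g : Z → Y) : Prop :=
  IsLVFunctor C B g ∧
    ∀ zs y, B.lowerStar g zs y = ⨅ xs, (VRel.hat j xs zs ⇨ₗ B.lowerStar f xs y)

end List

section Proofs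

variable {V : Type v} [CommMonoid V] [CompleteLattice V] [IsQuantale V]
variable {X Y Z : Type*}

/-- The elementwise form of `a ∘ a ≤ a`. -/
theorem kcomp_le_iff (a : VRel V (List X) X) :
    VRel.kcomp a a ≤ a ↔
      ∀ xss ys z, VRel.list a xss ys * a ys z ≤ a xss.flatten z := by
  constructor
  · intro h xss ys z
    refine le_trans ?_ (h xss.flatten z)
    refine le_trans ?_ (le_iSup (fun ys => VRel.hat a xss.flatten ys * a ys z) ys)
    refine mul_le_mul' ?_ le_rfl
    exact le_iSup₂_of_le (f := fun (yss : List (List X)) (_ : yss.flatten = xss.flatten) =>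
      VRel.list a yss ys) xss rfl le_rfl
  · intro h xs z
    refine iSup_le fun ys => ?_
    simp only [VRel.hat]
    rw [iSup_mul_distrib]
    refine iSup_le fun xss => ?_
    by_cases hx : xss.flatten = xs
    · subst hx
      simpa using h xss ys z
    · simp [hx]

/-- The one-point `(L,V)`-category `E = (1, e°)`. -/
def LVCat.point (V : Type v) [CommMonoid V] [CompleteLattice V] [IsQuantale V] :
    LVCat V Unit where
  hom zs _ := if zs = [()] then 1 else ⊥
  id_le _ := by simp
  comp_le := by
    rw [kcomp_le_iff]
    intro xss ys z
    by_cases hy : ys = [()]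
    · subst hy
      match xss with
      | [] => simp [VRel.list]
      | [xs] => by_cases hx : xs = [()] <;> simp [VRel.list, hx]
      | _ :: _ :: _ => simp [VRel.list]
    · simp [hy]

end Proofs

/-! ### Promonoidal `V`-categories and `V`-quantum B-algebras -/

/-- A promonoidal `V`-category: a monoid in the monoidal quantaloid of distributors. -/
structure Promonoidal (V : Type v) [CommMonoid V] [CompleteLattice V] (X : Type u)
    extends VCat V X where
  /-- the distributor `X ⊠ X ⇸ X` -/
  P : X → X → X → V
  /-- the distributor `K ⇸ X` -/
  J : X → V
  P_left : ∀ x x' y y' z, hom x' x * hom y' y * P x y z ≤ P x' y' z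
  P_right : ∀ x y z z', P x y z * hom z z' ≤ P x y z'
  J_right : ∀ x y, J x * hom x y ≤ J y
  assoc : ∀ a b c d, ⨆ x, P a b x * P x c d = ⨆ x, P a x d * P b c x
  left_unit : ∀ x w, ⨆ z, J z * P z x w = hom x w
  right_unit : ∀ x w, ⨆ z, J z * P x z w = hom x w

/-- A `V`-quantum B-algebra: a representable promonoidal `V`-category.
Here `rres x y = x ▷ y` and `lres x y = x ◁ y`. -/
structure QBAlg (V : Type v) [CommMonoid V] [CompleteLattice V] (X : Type u)
    extends Promonoidal V X where
  rres : X → X → X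
  lres : X → X → X
  unit : X
  P_lres : ∀ x z y, P x z y = hom z (lres x y)
  P_rres : ∀ z x y, P z x y = hom z (rres x y)
  J_unit : ∀ x, J x = hom unit x

/-- Morphisms of `V`-quantum B-algebras. -/
structure IsQBHom {V : Type v} [CommMonoid V] [CompleteLattice V] {X Y : Type*}
    (A : QBAlg V X) (B : QBAlg V Y) (f : X → Y) : Prop where
  functor : IsVFunctor A.toVCat B.toVCat f
  rres : ∀ x y, B.le (f (A.rres x y)) (B.rres (f x) (f y))
  lres : ∀ x y, B.le (f (A.lres x y)) (B.lres (f x) (f y))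
  unit : B.le B.unit (f A.unit)

namespace QBAlg

variable {V : Type v} [CommMonoid V] [CompleteLattice V] {X : Type u}

/-- The `(L,V)`-structure of a quantum B-algebra:
`(x₁, …, xₙ), y ↦ a(x₁, x₂ ▷ (⋯ (xₙ ▷ y)))` and `(), y ↦ a(u, y)`. -/
def lhom (A : QBAlg V X) : VRel V (List X) X
  | [], y => A.hom A.unit y
  | x :: xs, y => A.hom x (xs.foldr A.rres y)

variable [IsQuantale V] (A : QBAlg V X)

theorem le_trans_hom {v : V} {x y z : X} (h : 1 ≤ A.hom x y) (h' : v ≤ A.hom y z) :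
    v ≤ A.hom x z := by
  calc v = 1 * v := (one_mul v).symm
    _ ≤ A.hom x y * A.hom y z := mul_le_mul' h h'
    _ ≤ _ := A.comp_le _ _ _

theorem hom_trans_le {v : V} {x y z : X} (h : v ≤ A.hom x y) (h' : 1 ≤ A.hom y z) :
    v ≤ A.hom x z := by
  calc v = v * 1 := (mul_one v).symm
    _ ≤ A.hom x y * A.hom y z := mul_le_mul' h h'
    _ ≤ _ := A.comp_le _ _ _

theorem rres_mono (x y y' : X) : A.hom y y' ≤ A.hom (A.rres x y) (A.rres x y') := by
  have h := A.P_right (A.rres x y) x y y'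
  rw [A.P_rres, A.P_rres] at h
  refine le_trans ?_ h
  calc A.hom y y' = 1 * A.hom y y' := (one_mul _).symm
    _ ≤ _ := mul_le_mul' (A.id_le _) le_rfl

theorem rres_anti (y y' z : X) : A.hom y' y ≤ A.hom (A.rres y z) (A.rres y' z) := by
  have h := A.P_left (A.rres y z) (A.rres y z) y y' z
  rw [A.P_rres, A.P_rres] at h
  refine le_trans ?_ h
  calc A.hom y' y = 1 * A.hom y' y * 1 := by simp
    _ ≤ _ := mul_le_mul' (mul_le_mul' (A.id_le _) le_rfl) (A.id_le _)

theorem unit_rres (x y : X) : A.hom A.unit (A.rres x y) = A.hom x y := by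
  rw [← A.left_unit x y]
  simp only [A.J_unit, A.P_rres]
  apply le_antisymm
  · refine le_trans ?_ (le_iSup _ A.unit)
    calc A.hom A.unit (A.rres x y) = 1 * A.hom A.unit (A.rres x y) := (one_mul _).symm
      _ ≤ _ := mul_le_mul' (A.id_le _) le_rfl
  · exact iSup_le fun z => A.comp_le _ _ _

theorem le_unit_rres (y : X) : 1 ≤ A.hom (A.rres A.unit y) y := by
  rw [← A.right_unit (A.rres A.unit y) y]
  refine le_trans ?_ (le_iSup _ A.unit)
  rw [A.J_unit, A.P_rres]
  calc (1 : V) = 1 * 1 := (one_mul 1).symm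
    _ ≤ _ := mul_le_mul' (A.id_le _) (A.id_le _)

theorem rres_rres (x y z : X) :
    1 ≤ A.hom (A.rres y z) (A.rres (A.rres x y) (A.rres x z)) := by
  have h1 : (1 : V) ≤ ⨆ w, A.P (A.rres y z) w z * A.P (A.rres x y) x w := by
    refine le_trans ?_ (le_iSup _ y)
    rw [A.P_rres, A.P_rres]
    calc (1 : V) = 1 * 1 := (one_mul 1).symm
      _ ≤ _ := mul_le_mul' (A.id_le _) (A.id_le _)
  rw [← A.assoc] at h1
  refine h1.trans (iSup_le fun w => ?_)
  rw [A.P_rres w x z, ← A.P_rres (A.rres y z)]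
  exact A.P_right _ _ _ _

theorem lhom_eq (xs : List X) (y : X) : A.lhom xs y = A.hom A.unit (xs.foldr A.rres y) := by
  cases xs with
  | nil => rfl
  | cons x xs => exact (A.unit_rres _ _).symm

theorem foldr_mono (xs : List X) (y y' : X) :
    A.hom y y' ≤ A.hom (xs.foldr A.rres y) (xs.foldr A.rres y') := by
  induction xs with
  | nil => exact le_rfl
  | cons x xs ih => exact ih.trans (A.rres_mono _ _ _)

theorem foldr_rres (xs : List X) (y z : X) :
    1 ≤ A.hom (A.rres y z) (A.rres (xs.foldr A.rres y) (xs.foldr A.rres z)) := by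
  induction xs with
  | nil => exact A.id_le _
  | cons x xs ih => exact A.le_trans_hom ih (A.rres_rres x _ _)

theorem lhom_le (xs : List X) (y z : X) :
    A.lhom xs y ≤ A.hom (A.rres y z) (xs.foldr A.rres z) := by
  rw [A.lhom_eq]
  refine A.le_trans_hom (A.foldr_rres xs y z) (A.hom_trans_le ?_ (A.le_unit_rres _))
  exact A.rres_anti _ _ _

theorem list_lhom_le (xss : List (List X)) (ys : List X) (z : X) :
    VRel.list A.lhom xss ys ≤
      A.hom (ys.foldr A.rres z) (xss.flatten.foldr A.rres z) := by
  induction xss generalizing ys with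
  | nil =>
    cases ys with
    | nil => exact A.id_le z
    | cons y ys => simp [VRel.list]
  | cons xs xss ih =>
    cases ys with
    | nil => simp [VRel.list]
    | cons y ys =>
      simp only [VRel.list, List.foldr_cons, List.flatten_cons, List.foldr_append]
      refine le_trans (mul_le_mul' (A.lhom_le xs y (ys.foldr A.rres z)) ((ih ys).trans (A.foldr_mono xs _ _))) ?_
      exact A.comp_le _ _ _

/-- A `V`-quantum B-algebra as an `(L,V)`-category. -/
def toLVCat : LVCat V X where
  hom := A.lhom
  id_le x := A.id_le x
  comp_le := by
    rw [kcomp_le_iff]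
    intro xss ys z
    rw [A.lhom_eq ys, A.lhom_eq xss.flatten, mul_comm]
    exact le_trans (mul_le_mul' le_rfl (A.list_lhom_le xss ys z)) (A.comp_le _ _ _)

end QBAlg

/-! ### `V`-quantales -/

/-- A monoidal `V`-category. -/
structure MonVCat (V : Type v) [CommMonoid V] [CompleteLattice V] (X : Type u)
    extends VCat V X where
  mul : X → X → X
  unit : X
  mul_assoc : ∀ x y z, mul (mul x y) z = mul x (mul y z)
  unit_mul : ∀ x, mul unit x = x
  mul_unit : ∀ x, mul x unit = x
  mul_functor : ∀ x x' y y', hom x x' * hom y y' ≤ hom (mul x y) (mul x' y')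

/-- A `V`-quantale: a monoid in the category of separated cocomplete `V`-categories and
cocontinuous `V`-functors, that is, a separated cocomplete monoidal `V`-category
whose multiplication is cocontinuous in each variable. -/
structure VQuantale (V : Type v) [CommMonoid V] [CompleteLattice V] (Q : Type u)
    extends MonVCat V Q where
  separated : toVCat.Separated
  cocomplete : toVCat.Cocomplete
  mul_left_cocontinuous : ∀ x, IsCocontinuous toVCat toVCat (fun y => mul x y)
  mul_right_cocontinuous : ∀ x, IsCocontinuous toVCat toVCat (fun y => mul y x)

namespace MonVCat

variable {V : Type v} [CommMonoid V] [CompleteLattice V] {X : Type u}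

/-- `α(x₁, …, xₙ) = x₁ * ⋯ * xₙ`, with `α() = u`. -/
def prod (M : MonVCat V X) (xs : List X) : X := xs.foldr M.mul M.unit

variable (M : MonVCat V X)

theorem prod_append (xs ys : List X) : M.prod (xs ++ ys) = M.mul (M.prod xs) (M.prod ys) := by
  induction xs with
  | nil => simp [prod, M.unit_mul]
  | cons x xs ih =>
    have h : ∀ zs, M.prod (x :: zs) = M.mul x (M.prod zs) := fun _ => rfl
    rw [List.cons_append, h, h, ih, M.mul_assoc]

variable [IsQuantale V]

theorem list_prod_le (xss : List (List X)) (ys : List X) :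
    VRel.list (fun xs y => M.hom (M.prod xs) y) xss ys ≤
      M.hom (M.prod xss.flatten) (M.prod ys) := by
  induction xss generalizing ys with
  | nil =>
    cases ys with
    | nil => exact M.id_le _
    | cons y ys => simp [VRel.list]
  | cons xs xss ih =>
    cases ys with
    | nil => simp [VRel.list]
    | cons y ys =>
      simp only [VRel.list, List.flatten_cons, prod_append]
      exact le_trans (mul_le_mul' le_rfl (ih ys)) (M.mul_functor _ _ _ _)

/-- A monoidal `V`-category as an `(L,V)`-category: `(xs, y) ↦ a(α xs, y)`. -/
def toLVCat : LVCat V X where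
  hom xs y := M.hom (M.prod xs) y
  id_le x := by simpa [prod, M.mul_unit] using M.id_le x
  comp_le := by
    rw [kcomp_le_iff]
    intro xss ys z
    exact le_trans (mul_le_mul' (M.list_prod_le xss ys) le_rfl) (M.comp_le _ _ _)

end MonVCat

namespace VQuantale

variable {V : Type v} [CommMonoid V] [CompleteLattice V] {Q : Type u}

theorem mul_hom_left (Q' : VQuantale V Q) (x x' y : Q) : Q'.hom x x' ≤ Q'.hom (Q'.mul x y) (Q'.mul x' y) :=
  (Q'.mul_right_cocontinuous y).1 x x'

theorem mul_hom_right (Q' : VQuantale V Q) (x y y' : Q) : Q'.hom y y' ≤ Q'.hom (Q'.mul x y) (Q'.mul x y') :=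
  (Q'.mul_left_cocontinuous x).1 y y'

variable [IsQuantale V]

/-- A cocontinuous endofunctor `F` of a cocomplete `V`-category has a right adjoint,
`z ↦ colim (b(F -, z), Id)`. -/
theorem exists_rightAdjoint {B : VCat V Q} (hB : B.Cocomplete) {F : Q → Q}
    (hF : IsCocontinuous B B F) (z : Q) : ∃ r, ∀ x, B.hom (F x) z = B.hom x r := by
  let K : VCat V PUnit.{u + 1} :=
    { hom := fun _ _ => 1, id_le := fun _ => le_rfl, comp_le := fun _ _ _ => by simp }
  let j : VRel V Q PUnit.{u + 1} := fun x _ => B.hom (F x) z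
  have hid : IsVFunctor B B (id : Q → Q) := fun _ _ => le_rfl
  have hj : IsVDistributor B K j := by
    refine ⟨fun x t => iSup_le fun y => ?_, fun x t => iSup_le fun y => ?_⟩
    · exact le_trans (mul_le_mul' (hF.1 _ _) le_rfl) (B.comp_le _ _ _)
    · simp [K, j]
  obtain ⟨g, hg⟩ := hB Q PUnit B K id j hid hj
  have hFg := hF.2 Q PUnit B K id j g hid hj hg
  refine ⟨g ⟨⟩, fun x => le_antisymm ?_ ?_⟩
  · have h1 := hg.2 ⟨⟩ (g ⟨⟩)
    have h2 : (1 : V) ≤ j x ⟨⟩ ⇨ₗ B.lowerStar id x (g ⟨⟩) :=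
      ((B.id_le (g ⟨⟩)).trans h1.le).trans (iInf_le _ x)
    rw [leftMulResiduation_le_iff_mul_le, one_mul] at h2
    exact h2
  · have h1 := hFg.2 ⟨⟩ z
    have h2 : (1 : V) ≤ B.hom (F (g ⟨⟩)) z := by
      refine le_trans (le_iInf fun y => ?_) h1.ge
      rw [leftMulResiduation_le_iff_mul_le, one_mul]
      exact le_rfl
    calc B.hom x (g ⟨⟩) = B.hom x (g ⟨⟩) * 1 := (mul_one _).symm
      _ ≤ B.hom (F x) (F (g ⟨⟩)) * B.hom (F (g ⟨⟩)) z := mul_le_mul' (hF.1 _ _) h2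
      _ ≤ _ := B.comp_le _ _ _

variable (Q' : VQuantale V Q)

/-- `y ▷ z`: the value at `z` of the right adjoint of `- * y`. -/
noncomputable def rres (y z : Q) : Q :=
  Classical.choose (exists_rightAdjoint Q'.cocomplete (Q'.mul_right_cocontinuous y) z)

/-- `x ◁ z`: the value at `z` of the right adjoint of `x * -`. -/
noncomputable def lres (x z : Q) : Q :=
  Classical.choose (exists_rightAdjoint Q'.cocomplete (Q'.mul_left_cocontinuous x) z)

theorem hom_rres (x y z : Q) : Q'.hom (Q'.mul x y) z = Q'.hom x (Q'.rres y z) :=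
  Classical.choose_spec
    (exists_rightAdjoint Q'.cocomplete (Q'.mul_right_cocontinuous y) z) x

theorem hom_lres (x y z : Q) : Q'.hom (Q'.mul x y) z = Q'.hom y (Q'.lres x z) :=
  Classical.choose_spec
    (exists_rightAdjoint Q'.cocomplete (Q'.mul_left_cocontinuous x) z) y

theorem iSup_hom_mul (x : Q) {G : Q → V}
    (hG : ∀ y y', Q'.hom y y' * G y' ≤ G y) : ⨆ y, Q'.hom x y * G y = G x := by
  apply le_antisymm
  · exact iSup_le fun y => hG x y
  · refine le_trans ?_ (le_iSup _ x)
    calc G x = 1 * G x := (one_mul _).symm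
      _ ≤ _ := mul_le_mul' (Q'.id_le x) le_rfl

/-- A `V`-quantale as a `V`-quantum B-algebra. -/
noncomputable def toQBAlg : QBAlg V Q where
  toVCat := Q'.toVCat
  P x y z := Q'.hom (Q'.mul x y) z
  J x := Q'.hom Q'.unit x
  P_left _ _ _ _ _ := le_trans (mul_le_mul' (Q'.mul_functor _ _ _ _) le_rfl) (Q'.comp_le _ _ _)
  P_right _ _ _ _ := Q'.comp_le _ _ _
  J_right _ _ := Q'.comp_le _ _ _
  assoc a b c d := by
    rw [Q'.iSup_hom_mul (Q'.mul a b) (G := fun x => Q'.hom (Q'.mul x c) d)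
      (fun y y' => le_trans (mul_le_mul' (Q'.mul_hom_left _ _ _) le_rfl) (Q'.comp_le _ _ _))]
    simp only [mul_comm (Q'.hom (Q'.mul a _) d)]
    rw [Q'.iSup_hom_mul (Q'.mul b c) (G := fun x => Q'.hom (Q'.mul a x) d)
      (fun y y' => le_trans (mul_le_mul' (Q'.mul_hom_right _ _ _) le_rfl) (Q'.comp_le _ _ _))]
    rw [Q'.mul_assoc]
  left_unit x w := by
    rw [Q'.iSup_hom_mul Q'.unit (G := fun z => Q'.hom (Q'.mul z x) w)
      (fun y y' => le_trans (mul_le_mul' (Q'.mul_hom_left _ _ _) le_rfl) (Q'.comp_le _ _ _))]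
    rw [Q'.unit_mul]
  right_unit x w := by
    rw [Q'.iSup_hom_mul Q'.unit (G := fun z => Q'.hom (Q'.mul x z) w)
      (fun y y' => le_trans (mul_le_mul' (Q'.mul_hom_right _ _ _) le_rfl) (Q'.comp_le _ _ _))]
    rw [Q'.mul_unit]
  rres := Q'.rres
  lres := Q'.lres
  unit := Q'.unit
  P_lres x z y := Q'.hom_lres x z y
  P_rres z x y := Q'.hom_rres z x y
  J_unit _ := rfl

/-- The two ways of viewing a `V`-quantale as an `(L,V)`-category agree. -/
theorem toQBAlg_toLVCat_hom (qs : List Q) (q : Q) :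
    Q'.toQBAlg.toLVCat.hom qs q = Q'.toLVCat.hom qs q := by
  have h : ∀ (xs : List Q) (q : Q),
      Q'.hom Q'.unit (xs.foldr Q'.rres q) = Q'.hom (Q'.prod xs) q := by
    intro xs
    induction xs using List.reverseRecOn with
    | nil => intro q; rfl
    | append_singleton xs x ih =>
      intro q
      rw [List.foldr_append, List.foldr_cons, List.foldr_nil, ih, ← Q'.hom_rres,
        MonVCat.prod_append]
      congr 2
      exact (Q'.mul_unit x).symm
  exact (Q'.toQBAlg.lhom_eq qs q).trans (h qs q)

end VQuantale

/-! ### Dense and essential morphisms -/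

section Main

variable {V : Type v} [CommMonoid V] [CompleteLattice V] [IsQuantale V]

/-- A fully faithful `(L,V)`-functor `i : (X, a) → Q` into a `V`-quantale is dense if every
`q`, seen as a point of `Q`, is the `V`-limit of `i` weighted by `i^* · q_*` and the
`(L,V)`-colimit of `i` weighted by `q^⊛ ∘ i_⊛`. -/
def IsDense {X : Type*} {Q : Type u} (A : LVCat V X) (Q' : VQuantale V Q) (i : X → Q) : Prop :=
  IsLVFullyFaithful A Q'.toLVCat i ∧
  ∀ q : Q,
    IsVLim (VCat.point V) Q'.toVCat
      (VRel.comp (Q'.toVCat.upperStar i) (Q'.toVCat.lowerStar (fun _ : Unit => q)))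
      i (fun _ : Unit => q) ∧
    IsLVColim (LVCat.point V) Q'.toLVCat
      (VRel.kcomp (Q'.toLVCat.upperStar (fun _ : Unit => q)) (Q'.toLVCat.lowerStar i))
      i (fun _ : Unit => q)

/-- Essential embeddings in the category of `(L,V)`-categories. -/
def IsEssentialLV {X Y : Type u} (A : LVCat V X) (B : LVCat V Y) (e : X → Y) : Prop :=
  IsLVFullyFaithful A B e ∧
  ∀ (Z : Type u) (C : LVCat V Z) (f : Y → Z),
    IsLVFunctor B C f → IsLVFullyFaithful A C (f ∘ e) → IsLVFullyFaithful B C f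

/-- Essential embeddings in the category of `V`-quantum B-algebras. -/
def IsEssentialQB {X Y : Type u} (A : QBAlg V X) (B : QBAlg V Y) (e : X → Y) : Prop :=
  IsLVFullyFaithful A.toLVCat B.toLVCat e ∧
  ∀ (Z : Type u) (C : QBAlg V Z) (f : Y → Z), IsQBHom B C f →
    IsLVFullyFaithful A.toLVCat C.toLVCat (f ∘ e) →
      IsLVFullyFaithful B.toLVCat C.toLVCat f

end Main

end QEnr

/-!
Unwinding the weights, `i : X → Q` is dense iff it is fully faithful and, for all `q`, `t`, `y`,

* `Q(t, q) = ⨅ x, [Q(q, i x), Q(t, i x)]` (`IsLimitDense`), and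
* `Q(q, y) = ⨅ p, [Q(p, q), Q(p, y)]`, with `p` running over the finite products
  `i x₁ * ⋯ * i xₙ` (`IsColimitDense`).

The `(L,V)`-colimit condition also concerns words of length other than one, but since `*` is
residuated these follow from the second formula (`IsColimitDense.le_hom_prod`).

Dense implies essential (`IsDense.isEssentialLV`): for `f : Q → C`, the two formulas bound
`C(f q₁, …, f qₙ; f q)` by values at words in the image of `X`, where `f` is fully faithful.
Morphisms of quantum B-algebras are `(L,V)`-functors, so an embedding essential among all
`(L,V)`-categories is essential among quantum B-algebras.

Essential among quantum B-algebras implies dense: it is enough to test essentiality on two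
quotients of `Q`. Each is carried by the set `Q` itself with a larger hom, so that the quotient map
is the identity and no question of size arises.

* Let `c q` be the canonical colimit of products `p` over `q`. The elements fixed by the
  coreflection `c` contain the unit and are closed under `*`, so `Q(c a, b)` is the hom of a
  quantum B-algebra and `id` is a morphism onto it. As `c` fixes all products, `id ∘ i` is fully
  faithful; hence so is `id`, that is `Q(c a, b) = Q(a, b)`, which is colimit density.
* Let `n q` be the canonical limit of the elements `i x` under `q`. Colimit density makes the
  elements fixed by `n` stable under residuation: a residual of `i x` by an arbitrary element is a
  limit of residuals of `i x` by products `p`, and these lie in the image of `i` because `i` is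
  fully faithful (`IsColimitDense.nucleus_rres`). So `Q(a, n b)` is the hom of a quantum B-algebra,
  and as before `id` is fully faithful, that is `Q(a, n b) = Q(a, b)`, which is limit density.
-/

namespace QEnr

open Quantale

/-! ### Relations and the Yoneda lemma -/

section Relations

variable {V : Type v} [CommMonoid V] [CompleteLattice V]

theorem VRel.list_comp_right {X Y Z : Type*} (r : VRel V X Y) (g : Z → Y) (xs : List X)
    (zs : List Z) :
    VRel.list (fun x z => r x (g z)) xs zs = VRel.list r xs (zs.map g) := by
  induction xs generalizing zs with
  | nil => cases zs <;> simp [VRel.list]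
  | cons x xs ih => cases zs <;> simp [VRel.list, ih]

variable [IsQuantale V]

theorem VRel.list_mono {X X' Y Y' : Type*} {r : VRel V X Y} {s : VRel V X' Y'} (f : X → X')
    (g : Y → Y') (h : ∀ x y, r x y ≤ s (f x) (g y)) (xs : List X) (ys : List Y) :
    VRel.list r xs ys ≤ VRel.list s (xs.map f) (ys.map g) := by
  induction xs generalizing ys with
  | nil => cases ys <;> simp [VRel.list]
  | cons x xs ih =>
    cases ys with
    | nil => simp [VRel.list]
    | cons y ys => exact mul_le_mul' (h x y) (ih ys)

theorem VRel.hat_mul_le_iff {X Z : Type*} (j : VRel V (List X) Z) (xs : List X) (zs : List Z)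
    (v w : V) :
    VRel.hat j xs zs * v ≤ w ↔ ∀ xss, xss.flatten = xs → VRel.list j xss zs * v ≤ w := by
  simp only [← leftMulResiduation_le_iff_mul_le, VRel.hat, iSup_le_iff]

theorem VRel.le_iInf_hat_residual_iff {X Z : Type*} (j : VRel V (List X) Z) (φ : List X → V)
    (zs : List Z) (v : V) :
    v ≤ ⨅ xs, (VRel.hat j xs zs ⇨ₗ φ xs) ↔
      ∀ xss, VRel.list j xss zs * v ≤ φ xss.flatten := by
  simp only [le_iInf_iff, leftMulResiduation_le_iff_mul_le, mul_comm v, VRel.hat_mul_le_iff]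
  exact ⟨fun h xss => h _ xss rfl, fun h _ xss hx => hx ▸ h xss⟩

theorem LVCat.list_mul_hom_le {X : Type*} (C : LVCat V X) (xss : List (List X)) (ys : List X)
    (z : X) : VRel.list C.hom xss ys * C.hom ys z ≤ C.hom xss.flatten z :=
  (kcomp_le_iff C.hom).1 C.comp_le xss ys z

end Relations

section Yoneda

variable {V : Type v} [CommMonoid V] [CompleteLattice V] [IsQuantale V] {X : Type*}

theorem VCat.hom_le_of_le (B : VCat V X) {x y : X} (h : B.le x y) (t : X) :
    B.hom t x ≤ B.hom t y :=
  (le_mul_of_one_le_right' h).trans (B.comp_le t x y)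

theorem VCat.le_hom_of_le (B : VCat V X) {x y : X} (h : B.le x y) (t : X) :
    B.hom y t ≤ B.hom x t :=
  (le_mul_of_one_le_left' h).trans (B.comp_le x y t)

/-- The Yoneda lemma for a presheaf on a `V`-category. -/
theorem VCat.iSup_hom_mul (B : VCat V X) (x : X) {G : X → V}
    (hG : ∀ y y', B.hom y y' * G y' ≤ G y) : ⨆ y, B.hom x y * G y = G x :=
  le_antisymm (iSup_le fun y => hG x y)
    ((le_mul_of_one_le_left' (B.id_le x)).trans (le_iSup (fun y => B.hom x y * G y) x))

/-- The Yoneda lemma for a copresheaf on a `V`-category. -/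
theorem VCat.iSup_mul_hom (B : VCat V X) (x : X) {G : X → V}
    (hG : ∀ y y', G y * B.hom y y' ≤ G y') : ⨆ y, G y * B.hom y x = G x :=
  le_antisymm (iSup_le fun y => hG y x)
    ((le_mul_of_one_le_right' (B.id_le x)).trans (le_iSup (fun y => G y * B.hom y x) x))

end Yoneda

/-! ### Quantum B-algebras and their morphisms -/

namespace QBAlg

variable {V : Type v} [CommMonoid V] [CompleteLattice V] [IsQuantale V]

section

variable {X : Type*} (A : QBAlg V X)

theorem hom_unit_rres (x y : X) : A.hom x (A.rres A.unit y) = A.hom x y := by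
  refine le_antisymm (A.hom_le_of_le (A.le_unit_rres y) x) ?_
  rw [← A.right_unit x y]
  refine iSup_le fun z => ?_
  rw [A.J_unit, ← A.P_rres]
  refine le_trans ?_ (A.P_left x x z A.unit y)
  rw [mul_assoc]
  exact le_mul_of_one_le_left' (A.id_le x)

/-- The two residuations commute; this is associativity of the promonoidal structure. -/
theorem hom_rres_lres (a b c d : X) :
    A.hom b (A.rres c (A.lres a d)) = A.hom b (A.lres a (A.rres c d)) := by
  have h := A.assoc a b c d
  simp only [A.P_rres _ c d, A.P_lres a _ d] at h
  rw [A.iSup_mul_hom _ (A.P_right a b)] at h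
  simp only [mul_comm (A.hom _ (A.lres a d))] at h
  rw [A.iSup_mul_hom _ (A.P_right b c)] at h
  rw [← A.P_rres, ← h, A.P_lres]

theorem hom_foldr_lres (a t x : X) (zs : List X) :
    A.hom t (zs.foldr A.rres (A.lres a x)) = A.hom t (A.lres a (zs.foldr A.rres x)) := by
  induction zs generalizing t with
  | nil => rfl
  | cons z zs ih =>
    rw [List.foldr_cons, List.foldr_cons, ← A.hom_rres_lres]
    have h1 : A.le (zs.foldr A.rres (A.lres a x)) (A.lres a (zs.foldr A.rres x)) :=
      (A.id_le _).trans (ih _).le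
    have h2 : A.le (A.lres a (zs.foldr A.rres x)) (zs.foldr A.rres (A.lres a x)) :=
      (A.id_le _).trans (ih _).ge
    exact le_antisymm (A.hom_le_of_le (h1.trans (A.rres_mono _ _ _)) t)
      (A.hom_le_of_le (h2.trans (A.rres_mono _ _ _)) t)

theorem lhom_cons (a x : X) (zs : List X) : A.lhom (a :: zs) x = A.lhom zs (A.lres a x) := by
  rw [A.lhom_eq zs, A.hom_foldr_lres, ← A.P_lres, A.P_rres, A.hom_unit_rres]
  rfl

theorem lhom_concat (a x : X) (zs : List X) :
    A.lhom (zs ++ [a]) x = A.lhom zs (A.rres a x) := by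
  rw [A.lhom_eq, A.lhom_eq, List.foldr_append]
  rfl

end

section OfMul

variable {X : Type u}

/-- The `V`-quantum B-algebra whose promonoidal structure is represented by a multiplication
`m` on a `V`-category which has right adjoints in each variable, and is associative and unital
up to isomorphism. -/
def ofMul (B : VCat V X) (m : X → X → X) (r l : X → X → X) (u : X)
    (hr : ∀ x y z, B.hom (m x y) z = B.hom x (r y z))
    (hl : ∀ x y z, B.hom (m x y) z = B.hom y (l x z))
    (hassoc : ∀ x y z w, B.hom (m (m x y) z) w = B.hom (m x (m y z)) w)
    (hleft : ∀ x w, B.hom (m u x) w = B.hom x w)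
    (hright : ∀ x w, B.hom (m x u) w = B.hom x w) : QBAlg V X where
  toVCat := B
  P x y z := B.hom (m x y) z
  J x := B.hom u x
  P_left x x' y y' z := by
    have h1 : B.hom x' x * B.hom (m x y) z ≤ B.hom (m x' y) z := by
      rw [hr, hr]
      exact B.comp_le _ _ _
    have h2 : B.hom y' y * B.hom (m x' y) z ≤ B.hom (m x' y') z := by
      rw [hl, hl]
      exact B.comp_le _ _ _
    rw [mul_comm (B.hom x' x), mul_assoc]
    exact (mul_le_mul' le_rfl h1).trans h2
  P_right _ _ _ _ := B.comp_le _ _ _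
  J_right _ _ := B.comp_le _ _ _
  assoc a b c d := by
    simp only [mul_comm (B.hom (m a _) d)]
    rw [B.iSup_hom_mul (m a b) (G := fun x => B.hom (m x c) d)
        (fun y y' => by simpa only [hr] using B.comp_le _ _ _),
      B.iSup_hom_mul (m b c) (G := fun x => B.hom (m a x) d)
        (fun y y' => by simpa only [hl] using B.comp_le _ _ _), hassoc]
  left_unit x w := by
    rw [B.iSup_hom_mul u (G := fun z => B.hom (m z x) w)
      (fun y y' => by simpa only [hr] using B.comp_le _ _ _), hleft]
  right_unit x w := by
    rw [B.iSup_hom_mul u (G := fun z => B.hom (m x z) w)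
      (fun y y' => by simpa only [hl] using B.comp_le _ _ _), hright]
  rres := r
  lres := l
  unit := u
  P_lres := hl
  P_rres := hr
  J_unit _ := rfl

theorem ofMul_lhom {B : VCat V X} {m r l : X → X → X} {u : X}
    (hr : ∀ x y z, B.hom (m x y) z = B.hom x (r y z))
    (hl : ∀ x y z, B.hom (m x y) z = B.hom y (l x z))
    (hassoc : ∀ x y z w, B.hom (m (m x y) z) w = B.hom (m x (m y z)) w)
    (hleft : ∀ x w, B.hom (m u x) w = B.hom x w)
    (hright : ∀ x w, B.hom (m x u) w = B.hom x w) (xs : List X) (y : X) :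
    (ofMul B m r l u hr hl hassoc hleft hright).lhom xs y = B.hom (xs.foldl m u) y := by
  induction xs using List.reverseRecOn generalizing y with
  | nil => rfl
  | append_singleton xs x ih =>
    rw [lhom_concat, ih, List.foldl_append]
    exact (hr _ _ _).symm

end OfMul

end QBAlg

section Morphisms

variable {V : Type v} [CommMonoid V] [CompleteLattice V] [IsQuantale V]

theorem IsQBHom.isLVFunctor {X Y : Type*} {A : QBAlg V X} {B : QBAlg V Y} {f : X → Y}
    (hf : IsQBHom A B f) : IsLVFunctor A.toLVCat B.toLVCat f := by
  have hfold : ∀ (xs : List X) (y : X),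
      B.le (f (xs.foldr A.rres y)) ((xs.map f).foldr B.rres (f y)) := by
    intro xs y
    induction xs with
    | nil => exact B.id_le _
    | cons x xs ih =>
      exact B.le_trans_hom (hf.rres _ _) (ih.trans (B.rres_mono _ _ _))
  intro xs y
  change A.lhom xs y ≤ B.lhom (xs.map f) (f y)
  rw [A.lhom_eq, B.lhom_eq]
  exact B.hom_trans_le (B.le_trans_hom hf.unit (hf.functor _ _)) (hfold xs y)

theorem VQuantale.toLVCat_toQBAlg {Q : Type u} (Q' : VQuantale V Q) :
    Q'.toQBAlg.toLVCat = Q'.toLVCat := by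
  have h : Q'.toQBAlg.toLVCat.hom = Q'.toLVCat.hom :=
    funext fun qs => funext fun q => Q'.toQBAlg_toLVCat_hom qs q
  generalize Q'.toQBAlg.toLVCat = C at h
  generalize Q'.toLVCat = D at h
  cases C
  cases D
  congr

theorem IsEssentialLV.isEssentialQB {X Q : Type u} {A : QBAlg V X} {Q' : VQuantale V Q}
    {i : X → Q} (h : IsEssentialLV A.toLVCat Q'.toLVCat i) : IsEssentialQB A Q'.toQBAlg i := by
  rw [← Q'.toLVCat_toQBAlg] at h
  exact ⟨h.1, fun Z C f hf => h.2 Z C.toLVCat f hf.isLVFunctor⟩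

end Morphisms

/-! ### Density -/

section Density

variable {V : Type v} [CommMonoid V] [CompleteLattice V] [IsQuantale V]
variable {X Q : Type u} (Q' : VQuantale V Q) (i : X → Q)

/-- Every element of `Q` is the canonical `V`-limit of elements `i x`:
`⨅ x, [Q(q, i x), Q(t, i x)] ≤ Q(t, q)`, tested on lower bounds `v`. -/
def IsLimitDense : Prop :=
  ∀ (q t : Q) (v : V), (∀ x, Q'.hom q (i x) * v ≤ Q'.hom t (i x)) → v ≤ Q'.hom t q

/-- Every element of `Q` is the canonical `V`-colimit of products `i x₁ * ⋯ * i xₙ`: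
`⨅ xs, [Q(i x₁ * ⋯ * i xₙ, q), Q(i x₁ * ⋯ * i xₙ, y)] ≤ Q(q, y)`, tested on lower bounds `v`. -/
def IsColimitDense : Prop :=
  ∀ (q y : Q) (v : V),
    (∀ xs : List X, Q'.hom (Q'.prod (xs.map i)) q * v ≤ Q'.hom (Q'.prod (xs.map i)) y) →
      v ≤ Q'.hom q y

variable {Q' i}

/-- Since the multiplication of `Q` is residuated, colimit density in one variable gives it in
any finite number of variables. -/
theorem IsColimitDense.le_hom_prod (h : IsColimitDense Q' i) (qs : List Q) (y : Q) (v : V)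
    (hv : ∀ xss : List (List X),
      VRel.list (fun xs q => Q'.hom (Q'.prod (xs.map i)) q) xss qs * v ≤
        Q'.hom (Q'.prod (xss.flatten.map i)) y) :
    v ≤ Q'.hom (Q'.prod qs) y := by
  induction qs generalizing y v with
  | nil => simpa [VRel.list] using hv []
  | cons q qs ih =>
    change v ≤ Q'.hom (Q'.mul q (Q'.prod qs)) y
    rw [Q'.hom_rres]
    refine h _ _ _ fun xs => ?_
    rw [← Q'.hom_rres, Q'.hom_lres]
    refine ih _ _ fun xss => ?_
    rw [← Q'.hom_lres, ← Q'.prod_append, ← List.map_append]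
    refine le_trans (le_of_eq ?_) (hv (xs :: xss))
    simp only [VRel.list]
    rw [← mul_assoc, mul_comm (VRel.list _ xss qs)]

variable (Q' i)

theorem comp_upperStar_lowerStar (q : Q) (t : Unit) (x : X) :
    VRel.comp (Q'.toVCat.upperStar i) (Q'.toVCat.lowerStar (fun _ : Unit => q)) t x =
      Q'.hom q (i x) :=
  Q'.toVCat.iSup_hom_mul q (G := fun y => Q'.hom y (i x)) fun _ _ => Q'.comp_le _ _ _

theorem kcomp_upperStar_lowerStar (q : Q) :
    VRel.kcomp (Q'.toLVCat.upperStar (fun _ : Unit => q)) (Q'.toLVCat.lowerStar i) =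
      fun xs _ => Q'.hom (Q'.prod (xs.map i)) q := by
  funext xs t
  apply le_antisymm
  · refine iSup_le fun ys => ?_
    rw [VRel.hat_mul_le_iff]
    rintro xss rfl
    refine (mul_le_mul' (VRel.list_mono (s := Q'.toLVCat.hom) (List.map i) id
      (fun _ _ => le_rfl) xss ys) le_rfl).trans ?_
    rw [List.map_id, List.map_flatten]
    exact Q'.toLVCat.list_mul_hom_le _ _ _
  -- the product of `xs` itself, as a one-letter word, witnesses the supremum
  · refine le_trans ?_ (le_iSup _ [Q'.prod (xs.map i)])
    have h1 : (1 : V) ≤ VRel.hat (Q'.toLVCat.lowerStar i) xs [Q'.prod (xs.map i)] := by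
      refine le_iSup₂_of_le [xs] (by simp) ?_
      simp only [VRel.list, mul_one]
      exact Q'.id_le (Q'.prod (xs.map i))
    refine (le_mul_of_one_le_left' h1).trans (mul_le_mul' le_rfl (le_of_eq ?_))
    simp [LVCat.upperStar, MonVCat.toLVCat, MonVCat.prod, Q'.mul_unit]

theorem isVLim_iff :
    (∀ q : Q, IsVLim (VCat.point V) Q'.toVCat
      (VRel.comp (Q'.toVCat.upperStar i) (Q'.toVCat.lowerStar (fun _ : Unit => q)))
      i (fun _ : Unit => q)) ↔ IsLimitDense Q' i := by
  have key : ∀ (q t : Q) (v : V),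
      v ≤ ⨅ x, (VRel.comp (Q'.toVCat.upperStar i)
        (Q'.toVCat.lowerStar (fun _ : Unit => q)) () x ⇨ₗ Q'.toVCat.upperStar i t x) ↔
      ∀ x, Q'.hom q (i x) * v ≤ Q'.hom t (i x) := by
    intro q t v
    simp only [le_iInf_iff, leftMulResiduation_le_iff_mul_le, comp_upperStar_lowerStar,
      mul_comm v]
    rfl
  constructor
  · intro h q t v hv
    exact ((key q t v).2 hv).trans ((h q).2 t ()).ge
  · refine fun h q => ⟨fun _ _ => Q'.id_le q, fun t z => le_antisymm ?_ ?_⟩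
    · refine (key q t _).2 fun x => ?_
      rw [mul_comm]
      exact Q'.comp_le _ _ _
    · exact h q t _ ((key q t _).1 le_rfl)

theorem isLVColim_iff :
    (∀ q : Q, IsLVColim (LVCat.point V) Q'.toLVCat
      (VRel.kcomp (Q'.toLVCat.upperStar (fun _ : Unit => q)) (Q'.toLVCat.lowerStar i))
      i (fun _ : Unit => q)) ↔ IsColimitDense Q' i := by
  have key : ∀ (q y : Q) (zs : List Unit) (v : V),
      v ≤ ⨅ xs, (VRel.hat (VRel.kcomp (Q'.toLVCat.upperStar (fun _ : Unit => q))
        (Q'.toLVCat.lowerStar i)) xs zs ⇨ₗ Q'.toLVCat.lowerStar i xs y) ↔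
      ∀ xss : List (List X),
        VRel.list (fun xs q => Q'.hom (Q'.prod (xs.map i)) q) xss (zs.map fun _ => q) * v ≤
          Q'.hom (Q'.prod (xss.flatten.map i)) y := by
    intro q y zs v
    rw [VRel.le_iInf_hat_residual_iff, kcomp_upperStar_lowerStar]
    simp only [← VRel.list_comp_right (fun (xs : List X) q => Q'.hom (Q'.prod (xs.map i)) q)]
    rfl
  constructor
  · intro h q y v hv
    have h1 : v ≤ Q'.hom (Q'.prod [q]) y := by
      refine le_trans ?_ ((h q).2 [()] y).ge
      rw [key]
      intro xss
      match xss with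
      | [] => simp [VRel.list]
      | [xs] => simpa [VRel.list] using hv xs
      | _ :: _ :: _ => simp [VRel.list]
    simpa [MonVCat.prod, Q'.mul_unit] using h1
  · refine fun h q => ⟨fun zs z => ?_, fun zs y => le_antisymm ?_ ?_⟩
    · by_cases hz : zs = [()]
      · subst hz
        simpa [LVCat.point] using Q'.toLVCat.id_le q
      · simp [LVCat.point, hz]
    · refine (key q y zs _).2 fun xss => ?_
      refine (mul_le_mul' (VRel.list_mono (s := Q'.toLVCat.hom) (List.map i) id
        (fun _ _ => le_rfl) xss _) le_rfl).trans ?_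
      rw [List.map_id, List.map_flatten]
      exact Q'.toLVCat.list_mul_hom_le _ _ _
    · exact h.le_hom_prod _ _ _ ((key q y zs _).1 le_rfl)

theorem isDense_iff (A : LVCat V X) :
    IsDense A Q' i ↔
      IsLVFullyFaithful A Q'.toLVCat i ∧ IsLimitDense Q' i ∧ IsColimitDense Q' i := by
  rw [IsDense, forall_and, isVLim_iff, isLVColim_iff]

variable {Q' i}

theorem IsDense.isEssentialLV {A : LVCat V X} (h : IsDense A Q' i) :
    IsEssentialLV A Q'.toLVCat i := by
  obtain ⟨hff, hlim, hcolim⟩ := (isDense_iff Q' i A).1 h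
  refine ⟨hff, fun Z C f hf hfi qs q => le_antisymm (hf qs q) ?_⟩
  -- limit density reduces to a target of the form `i x`
  refine hlim q (Q'.prod qs) _ fun x => ?_
  have h1 : Q'.hom q (i x) * C.hom (qs.map f) (f q) ≤ C.hom (qs.map f) (f (i x)) := by
    have h2 : Q'.hom q (i x) ≤ C.hom [f q] (f (i x)) := by
      simpa [MonVCat.toLVCat, MonVCat.prod, Q'.mul_unit] using hf [q] (i x)
    rw [mul_comm]
    refine (mul_le_mul' le_rfl h2).trans ?_
    simpa [VRel.list] using C.list_mul_hom_le [qs.map f] [f q] (f (i x))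
  refine h1.trans ?_
  -- colimit density reduces to sources of the form `i x₁ * ⋯ * i xₙ`
  refine hcolim.le_hom_prod _ _ _ fun xss => ?_
  refine (mul_le_mul' (VRel.list_mono (s := C.hom) (List.map (f ∘ i)) f (fun xs q' => ?_) xss qs)
    le_rfl).trans ?_
  · rw [← List.map_map]
    exact hf (xs.map i) q'
  · refine (C.list_mul_hom_le _ _ _).trans (le_of_eq ?_)
    rw [← List.map_flatten]
    exact (hfi xss.flatten x).symm.trans (hff xss.flatten x)

end Density

/-! ### Essential embeddings are colimit dense -/

section Colimit

variable {V : Type v} [CommMonoid V] [CompleteLattice V] [IsQuantale V]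
variable {X Q : Type u} (Q' : VQuantale V Q) (i : X → Q)

/-- The canonical colimit of products of elements `i x` over `q` exists. -/
theorem exists_coreflection (q : Q) :
    ∃ c : Q, ∀ (y : Q) (v : V), v ≤ Q'.hom c y ↔
      ∀ xs : List X, Q'.hom (Q'.prod (xs.map i)) q * v ≤ Q'.hom (Q'.prod (xs.map i)) y := by
  let K : VCat V PUnit.{u + 1} :=
    { hom := fun _ _ => 1, id_le := fun _ => le_rfl, comp_le := fun _ _ _ => by simp }
  let π : List X → Q := fun xs => Q'.prod (xs.map i)
  let B : VCat V (List X) :=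
    { hom := fun xs ys => Q'.hom (π xs) (π ys)
      id_le := fun _ => Q'.id_le _
      comp_le := fun _ _ _ => Q'.comp_le _ _ _ }
  obtain ⟨g, -, hg⟩ := Q'.cocomplete (List X) PUnit B K π (fun xs _ => Q'.hom (π xs) q)
    (fun _ _ => le_rfl)
    ⟨fun xs t => iSup_le fun y => Q'.comp_le _ _ _, fun xs t => iSup_le fun y => by simp [K]⟩
  refine ⟨g ⟨⟩, fun y v => ?_⟩
  have h : Q'.hom (g ⟨⟩) y = _ := hg ⟨⟩ y
  simp only [h, le_iInf_iff, leftMulResiduation_le_iff_mul_le, mul_comm v]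
  rfl

/-- The coreflection of `q` into the colimit closure of the products of elements `i x`. -/
noncomputable def coreflection (q : Q) : Q := Classical.choose (exists_coreflection Q' i q)

theorem le_hom_coreflection_iff (q y : Q) (v : V) :
    v ≤ Q'.hom (coreflection Q' i q) y ↔
      ∀ xs : List X, Q'.hom (Q'.prod (xs.map i)) q * v ≤ Q'.hom (Q'.prod (xs.map i)) y :=
  Classical.choose_spec (exists_coreflection Q' i q) y v

theorem coreflection_le (q : Q) : Q'.le (coreflection Q' i q) q := by
  refine (le_hom_coreflection_iff Q' i q q 1).2 fun xs => ?_
  rw [mul_one]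

theorem hom_prod_coreflection (xs : List X) (q : Q) :
    Q'.hom (Q'.prod (xs.map i)) (coreflection Q' i q) = Q'.hom (Q'.prod (xs.map i)) q := by
  refine le_antisymm (Q'.hom_le_of_le (coreflection_le Q' i q) _) ?_
  simpa using (le_hom_coreflection_iff Q' i q _ 1).1 (Q'.id_le _) xs

theorem coreflection_eq_self_iff (q : Q) :
    coreflection Q' i q = q ↔ Q'.le q (coreflection Q' i q) :=
  ⟨fun h => (Q'.id_le q).trans (le_of_eq (by rw [h])),
    fun h => Q'.separated _ _ (coreflection_le Q' i q) h⟩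

theorem coreflection_prod (xs : List X) :
    coreflection Q' i (Q'.prod (xs.map i)) = Q'.prod (xs.map i) := by
  rw [coreflection_eq_self_iff]
  exact (Q'.id_le _).trans (hom_prod_coreflection Q' i xs _).ge

theorem coreflection_apply (x : X) : coreflection Q' i (i x) = i x := by
  simpa [MonVCat.prod, Q'.mul_unit] using coreflection_prod Q' i [x]

theorem coreflection_unit : coreflection Q' i Q'.unit = Q'.unit :=
  coreflection_prod Q' i []

/-- The coreflective elements are closed under multiplication. -/
theorem coreflection_mul (a b : Q) :
    coreflection Q' i (Q'.mul (coreflection Q' i a) (coreflection Q' i b)) =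
      Q'.mul (coreflection Q' i a) (coreflection Q' i b) := by
  rw [coreflection_eq_self_iff]
  set z := coreflection Q' i (Q'.mul (coreflection Q' i a) (coreflection Q' i b)) with hz
  change 1 ≤ Q'.hom _ _
  rw [Q'.hom_rres, le_hom_coreflection_iff]
  intro xs
  rw [← Q'.hom_rres, Q'.hom_lres, le_hom_coreflection_iff]
  intro ys
  rw [← Q'.hom_lres, ← Q'.prod_append, ← List.map_append, hz, hom_prod_coreflection,
    List.map_append, Q'.prod_append, ← hom_prod_coreflection Q' i xs,
    ← hom_prod_coreflection Q' i ys, mul_one, mul_comm]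
  exact Q'.mul_functor _ _ _ _

/-- The `V`-category on `Q` with hom `Q(c a, b)`, where `c` is the coreflection; it is equivalent
to the full subcategory of coreflective elements. -/
noncomputable def coreflectionVCat : VCat V Q where
  hom a b := Q'.hom (coreflection Q' i a) b
  id_le := coreflection_le Q' i
  comp_le a b d := by
    refine (le_hom_coreflection_iff Q' i a d _).2 fun xs => ?_
    rw [← hom_prod_coreflection, ← mul_assoc]
    refine (mul_le_mul' (Q'.comp_le _ _ _) le_rfl).trans ?_
    rw [← hom_prod_coreflection]
    exact Q'.comp_le _ _ _

/-- The `V`-quantum B-algebra of coreflective elements, carried by `Q`. -/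
noncomputable def coreflectionQBAlg : QBAlg V Q :=
  QBAlg.ofMul (coreflectionVCat Q' i)
    (fun a b => Q'.mul (coreflection Q' i a) (coreflection Q' i b))
    (fun y z => Q'.rres (coreflection Q' i y) z) (fun x z => Q'.lres (coreflection Q' i x) z)
    Q'.unit
    (fun x y z => by
      change Q'.hom (coreflection Q' i _) z = Q'.hom (coreflection Q' i x) _
      rw [coreflection_mul, Q'.hom_rres])
    (fun x y z => by
      change Q'.hom (coreflection Q' i _) z = Q'.hom (coreflection Q' i y) _
      rw [coreflection_mul, Q'.hom_lres])
    (fun x y z w => by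
      simp only [coreflection_mul, Q'.mul_assoc])
    (fun x w => by
      change Q'.hom (coreflection Q' i _) w = Q'.hom _ w
      rw [coreflection_mul, coreflection_unit, Q'.unit_mul])
    (fun x w => by
      change Q'.hom (coreflection Q' i _) w = Q'.hom _ w
      rw [coreflection_mul, coreflection_unit, Q'.mul_unit])

/-- The coreflection is lax monoidal, being right adjoint to a strict monoidal inclusion. -/
theorem isQBHom_id_coreflectionQBAlg :
    IsQBHom Q'.toQBAlg (coreflectionQBAlg Q' i) id where
  functor a b := Q'.le_hom_of_le (coreflection_le Q' i a) b
  rres x y := (coreflection_le Q' i _).trans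
    (Q'.toQBAlg.hom_le_of_le (((coreflection_le Q' i x)).trans (Q'.toQBAlg.rres_anti _ _ y)) _)
  lres x y := by
    change 1 ≤ Q'.hom (coreflection Q' i (Q'.lres x y)) (Q'.lres (coreflection Q' i x) y)
    rw [← Q'.hom_lres]
    refine le_trans ?_ (Q'.le_hom_of_le
      ((coreflection_le Q' i x).trans (Q'.mul_hom_left _ _ _)) _)
    rw [Q'.hom_lres]
    exact coreflection_le Q' i _
  unit := coreflection_le Q' i _

omit [IsQuantale V] in
theorem foldl_mul_eq_prod (xs : List Q) : xs.foldl Q'.mul Q'.unit = Q'.prod xs := by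
  induction xs using List.reverseRecOn with
  | nil => rfl
  | append_singleton xs x ih =>
    rw [List.foldl_append, ih, Q'.prod_append]
    simp [MonVCat.prod, Q'.mul_unit]

theorem coreflectionQBAlg_lhom_map (xs : List X) (q : Q) :
    (coreflectionQBAlg Q' i).lhom (xs.map i) q = Q'.hom (Q'.prod (xs.map i)) q := by
  have h : (xs.map i).foldl
      (fun a b => Q'.mul (coreflection Q' i a) (coreflection Q' i b)) Q'.unit =
        Q'.prod (xs.map i) := by
    induction xs using List.reverseRecOn with
    | nil => rfl
    | append_singleton xs x ih =>
      rw [List.map_append, List.foldl_append, ih, Q'.prod_append]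
      simp [MonVCat.prod, Q'.mul_unit, coreflection_apply]
      rw [← MonVCat.prod, coreflection_prod]
  rw [coreflectionQBAlg, QBAlg.ofMul_lhom, h]
  change Q'.hom (coreflection Q' i _) q = _
  rw [coreflection_prod]

theorem IsEssentialQB.isColimitDense {A : QBAlg V X} {Q' : VQuantale V Q} {i : X → Q}
    (h : IsEssentialQB A Q'.toQBAlg i) : IsColimitDense Q' i := by
  obtain ⟨hff, hess⟩ := h
  rw [Q'.toLVCat_toQBAlg] at hff
  have hid := hess Q (coreflectionQBAlg Q' i) id (isQBHom_id_coreflectionQBAlg Q' i)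
    fun xs x => (hff xs x).trans (coreflectionQBAlg_lhom_map Q' i xs (i x)).symm
  intro q y v hv
  exact ((le_hom_coreflection_iff Q' i q y v).2 hv).trans (hid [q] y).ge

end Colimit

/-! ### Essential embeddings are limit dense -/

section Limit

variable {V : Type v} [CommMonoid V] [CompleteLattice V] [IsQuantale V]
variable {X Q : Type u} (Q' : VQuantale V Q) (i : X → Q)

/-- The canonical limit of elements `i x` under `q` exists: it is the colimit of the identity
weighted by the presheaf it should represent. -/
theorem exists_nucleus (q : Q) :
    ∃ n : Q, ∀ (t : Q) (v : V), v ≤ Q'.hom t n ↔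
      ∀ x, Q'.hom q (i x) * v ≤ Q'.hom t (i x) := by
  let K : VCat V PUnit.{u + 1} :=
    { hom := fun _ _ => 1, id_le := fun _ => le_rfl, comp_le := fun _ _ _ => by simp }
  let φ : Q → V := fun t => ⨅ x, (Q'.hom q (i x) ⇨ₗ Q'.hom t (i x))
  have hφ : ∀ (t : Q) (v : V), v ≤ φ t ↔ ∀ x, Q'.hom q (i x) * v ≤ Q'.hom t (i x) := by
    intro t v
    simp only [φ, le_iInf_iff, leftMulResiduation_le_iff_mul_le, mul_comm v]
  have hφ' : ∀ t x, φ t * Q'.hom q (i x) ≤ Q'.hom t (i x) := fun t x => by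
    rw [mul_comm]
    exact (hφ t _).1 le_rfl x
  obtain ⟨g, -, hg⟩ := Q'.cocomplete Q PUnit Q'.toVCat K id (fun t _ => φ t)
    (fun _ _ => le_rfl)
    ⟨fun t _ => iSup_le fun t' => (hφ _ _).2 fun x => by
        rw [mul_comm, mul_assoc]
        exact (mul_le_mul' le_rfl (hφ' t' x)).trans (Q'.comp_le _ _ _),
      fun t _ => iSup_le fun y => by simp [K]⟩
  have hg' : ∀ y v, v ≤ Q'.hom (g ⟨⟩) y ↔ ∀ t, φ t * v ≤ Q'.hom t y := by
    intro y v
    have h : Q'.hom (g ⟨⟩) y = _ := hg ⟨⟩ y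
    simp only [h, le_iInf_iff, leftMulResiduation_le_iff_mul_le, mul_comm v]
    rfl
  refine ⟨g ⟨⟩, fun t v => ?_⟩
  rw [← hφ]
  have h1 : φ t ≤ Q'.hom t (g ⟨⟩) := by simpa using (hg' _ 1).1 (Q'.id_le _) t
  have h2 : Q'.hom t (g ⟨⟩) ≤ φ t := (hφ _ _).2 fun x => by
    rw [mul_comm]
    exact (mul_le_mul' le_rfl ((hg' _ _).2 fun t' => hφ' t' x)).trans (Q'.comp_le _ _ _)
  rw [le_antisymm h1 h2]

/-- The reflection of `q` into the limit closure of the elements `i x`. -/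
noncomputable def nucleus (q : Q) : Q := Classical.choose (exists_nucleus Q' i q)

theorem le_hom_nucleus_iff (q t : Q) (v : V) :
    v ≤ Q'.hom t (nucleus Q' i q) ↔ ∀ x, Q'.hom q (i x) * v ≤ Q'.hom t (i x) :=
  Classical.choose_spec (exists_nucleus Q' i q) t v

theorem le_nucleus (q : Q) : Q'.le q (nucleus Q' i q) := by
  refine (le_hom_nucleus_iff Q' i q q 1).2 fun x => ?_
  rw [mul_one]

theorem hom_nucleus_apply (q : Q) (x : X) :
    Q'.hom (nucleus Q' i q) (i x) = Q'.hom q (i x) := by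
  refine le_antisymm (Q'.le_hom_of_le (le_nucleus Q' i q) _) ?_
  simpa using (le_hom_nucleus_iff Q' i q _ 1).1 (Q'.id_le _) x

theorem nucleus_eq_self_iff (q : Q) : nucleus Q' i q = q ↔ Q'.le (nucleus Q' i q) q :=
  ⟨fun h => (Q'.id_le q).trans (le_of_eq (by rw [h])),
    fun h => Q'.separated _ _ h (le_nucleus Q' i q)⟩

theorem nucleus_apply (x : X) : nucleus Q' i (i x) = i x := by
  rw [nucleus_eq_self_iff]
  exact (Q'.id_le _).trans (hom_nucleus_apply Q' i _ x).ge

/-- The `V`-category on `Q` with hom `Q(a, n b)`, where `n` is the nucleus; it is equivalent to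
the full subcategory of closed elements. -/
noncomputable def nucleusVCat : VCat V Q where
  hom a b := Q'.hom a (nucleus Q' i b)
  id_le := le_nucleus Q' i
  comp_le a b d := by
    refine (le_hom_nucleus_iff Q' i d a _).2 fun x => ?_
    rw [← hom_nucleus_apply, mul_comm, mul_assoc]
    refine (mul_le_mul' le_rfl (Q'.comp_le _ _ _)).trans ?_
    rw [← hom_nucleus_apply Q' i b]
    exact Q'.comp_le _ _ _

/-- When the closed elements are stable under residuation, they form a `V`-quantum B-algebra,
carried by `Q`. -/
noncomputable def nucleusQBAlg
    (hr : ∀ q y, nucleus Q' i (Q'.rres q (nucleus Q' i y)) = Q'.rres q (nucleus Q' i y))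
    (hl : ∀ q y, nucleus Q' i (Q'.lres q (nucleus Q' i y)) = Q'.lres q (nucleus Q' i y)) :
    QBAlg V Q :=
  QBAlg.ofMul (nucleusVCat Q' i) Q'.mul (fun y z => Q'.rres y (nucleus Q' i z))
    (fun x z => Q'.lres x (nucleus Q' i z)) Q'.unit
    (fun x y z => by
      change Q'.hom _ (nucleus Q' i z) = Q'.hom x (nucleus Q' i _)
      rw [hr, Q'.hom_rres])
    (fun x y z => by
      change Q'.hom _ (nucleus Q' i z) = Q'.hom y (nucleus Q' i _)
      rw [hl, Q'.hom_lres])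
    (fun x y z w => by rw [Q'.mul_assoc])
    (fun x w => by rw [Q'.unit_mul])
    (fun x w => by rw [Q'.mul_unit])

variable {Q' i}

theorem isQBHom_id_nucleusQBAlg
    (hr : ∀ q y, nucleus Q' i (Q'.rres q (nucleus Q' i y)) = Q'.rres q (nucleus Q' i y))
    (hl : ∀ q y, nucleus Q' i (Q'.lres q (nucleus Q' i y)) = Q'.lres q (nucleus Q' i y)) :
    IsQBHom Q'.toQBAlg (nucleusQBAlg Q' i hr hl) id where
  functor _ b := Q'.hom_le_of_le (le_nucleus Q' i b) _
  rres x y := ((le_nucleus Q' i y).trans (Q'.toQBAlg.rres_mono x _ _)).trans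
    (Q'.hom_le_of_le (le_nucleus Q' i _) _)
  lres x y := by
    refine le_trans ?_ (Q'.hom_le_of_le (le_nucleus Q' i _) _)
    change 1 ≤ Q'.hom (Q'.lres x y) (Q'.lres x (nucleus Q' i y))
    rw [← Q'.hom_lres]
    refine le_trans ?_ (Q'.hom_le_of_le (le_nucleus Q' i y) _)
    rw [Q'.hom_lres]
    exact Q'.id_le _
  unit := le_nucleus Q' i _

theorem nucleusQBAlg_lhom
    (hr : ∀ q y, nucleus Q' i (Q'.rres q (nucleus Q' i y)) = Q'.rres q (nucleus Q' i y))
    (hl : ∀ q y, nucleus Q' i (Q'.lres q (nucleus Q' i y)) = Q'.lres q (nucleus Q' i y))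
    (qs : List Q) (q : Q) :
    (nucleusQBAlg Q' i hr hl).lhom qs q = Q'.hom (Q'.prod qs) (nucleus Q' i q) := by
  rw [nucleusQBAlg, QBAlg.ofMul_lhom, foldl_mul_eq_prod]
  rfl

omit [IsQuantale V] in
theorem IsColimitDense.hom_eq (h : IsColimitDense Q' i) {y y' : Q}
    (hy : ∀ xs : List X,
      Q'.hom (Q'.prod (xs.map i)) y = Q'.hom (Q'.prod (xs.map i)) y') (t : Q) :
    Q'.hom t y = Q'.hom t y' :=
  le_antisymm (h _ _ _ fun xs => (Q'.comp_le _ _ _).trans (hy xs).le)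
    (h _ _ _ fun xs => (Q'.comp_le _ _ _).trans (hy xs).ge)

/-- The image of `i` is stable under right residuation by products of its elements. -/
theorem IsColimitDense.exists_rres_prod {A : QBAlg V X} (h : IsColimitDense Q' i)
    (hff : IsLVFullyFaithful A.toLVCat Q'.toLVCat i) (xs : List X) (x : X) :
    ∃ z, ∀ t, Q'.hom (Q'.mul t (Q'.prod (xs.map i))) (i x) = Q'.hom t (i z) := by
  have step : ∀ a x t, Q'.hom (Q'.mul t (i a)) (i x) = Q'.hom t (i (A.rres a x)) := by
    intro a x t
    rw [Q'.hom_rres]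
    refine h.hom_eq (fun zs => ?_) t
    have h1 := (A.lhom_concat a x zs).symm.trans (hff (zs ++ [a]) x)
    refine Eq.trans ?_ (h1.symm.trans (hff zs (A.rres a x)))
    have h2 : Q'.prod ((zs ++ [a]).map i) = Q'.mul (Q'.prod (zs.map i)) (i a) := by
      rw [List.map_append, Q'.prod_append]
      simp [MonVCat.prod, Q'.mul_unit]
    rw [← Q'.hom_rres, ← h2]
    rfl
  induction xs with
  | nil => exact ⟨x, fun t => by simp [MonVCat.prod, Q'.mul_unit]⟩
  | cons a xs ih =>
    obtain ⟨z, hz⟩ := ih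
    refine ⟨A.rres a z, fun t => ?_⟩
    rw [← step, ← hz, Q'.mul_assoc]
    rfl

/-- The image of `i` is stable under left residuation by products of its elements. -/
theorem IsColimitDense.exists_lres_prod {A : QBAlg V X} (h : IsColimitDense Q' i)
    (hff : IsLVFullyFaithful A.toLVCat Q'.toLVCat i) (xs : List X) (x : X) :
    ∃ z, ∀ t, Q'.hom (Q'.mul (Q'.prod (xs.map i)) t) (i x) = Q'.hom t (i z) := by
  have step : ∀ a x t, Q'.hom (Q'.mul (i a) t) (i x) = Q'.hom t (i (A.lres a x)) := by
    intro a x t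
    rw [Q'.hom_lres]
    refine h.hom_eq (fun zs => ?_) t
    have h1 := (A.lhom_cons a x zs).symm.trans (hff (a :: zs) x)
    refine Eq.trans ?_ (h1.symm.trans (hff zs (A.lres a x)))
    rw [← Q'.hom_lres]
    rfl
  induction xs generalizing x with
  | nil => exact ⟨x, fun t => by simp [MonVCat.prod, Q'.unit_mul]⟩
  | cons a xs ih =>
    obtain ⟨z, hz⟩ := ih (A.lres a x)
    refine ⟨z, fun t => ?_⟩
    rw [← hz, ← step, ← Q'.mul_assoc]
    rfl

/-- Elements of `Q` are colimits of products `p` of elements `i x`, so `q ▷ n y` is a limit of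
the elements `p ▷ i x`, which lie in the image of `i`. -/
theorem IsColimitDense.nucleus_rres {A : QBAlg V X} (h : IsColimitDense Q' i)
    (hff : IsLVFullyFaithful A.toLVCat Q'.toLVCat i) (q y : Q) :
    nucleus Q' i (Q'.rres q (nucleus Q' i y)) = Q'.rres q (nucleus Q' i y) := by
  set r := Q'.rres q (nucleus Q' i y)
  have hrq : Q'.le (Q'.mul r q) (nucleus Q' i y) :=
    (Q'.id_le r).trans (Q'.hom_rres r q (nucleus Q' i y)).ge
  rw [nucleus_eq_self_iff]
  change 1 ≤ Q'.hom _ (Q'.rres q (nucleus Q' i y))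
  rw [← Q'.hom_rres, le_hom_nucleus_iff]
  intro x
  rw [Q'.hom_lres]
  refine h _ _ _ fun xs => ?_
  obtain ⟨z, hz⟩ := h.exists_rres_prod hff xs x
  rw [← Q'.hom_lres, hz, hom_nucleus_apply, ← hz, mul_one, ← hom_nucleus_apply]
  exact (mul_le_mul' (Q'.mul_hom_right r _ _) (Q'.le_hom_of_le hrq _)).trans
    (Q'.comp_le _ _ _)

theorem IsColimitDense.nucleus_lres {A : QBAlg V X} (h : IsColimitDense Q' i)
    (hff : IsLVFullyFaithful A.toLVCat Q'.toLVCat i) (q y : Q) :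
    nucleus Q' i (Q'.lres q (nucleus Q' i y)) = Q'.lres q (nucleus Q' i y) := by
  set r := Q'.lres q (nucleus Q' i y)
  have hrq : Q'.le (Q'.mul q r) (nucleus Q' i y) :=
    (Q'.id_le r).trans (Q'.hom_lres q r (nucleus Q' i y)).ge
  rw [nucleus_eq_self_iff]
  change 1 ≤ Q'.hom _ (Q'.lres q (nucleus Q' i y))
  rw [← Q'.hom_lres, le_hom_nucleus_iff]
  intro x
  rw [Q'.hom_rres]
  refine h _ _ _ fun xs => ?_
  obtain ⟨z, hz⟩ := h.exists_lres_prod hff xs x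
  rw [← Q'.hom_rres, hz, hom_nucleus_apply, ← hz, mul_one, ← hom_nucleus_apply]
  exact (mul_le_mul' (Q'.mul_hom_left _ _ r) (Q'.le_hom_of_le hrq _)).trans
    (Q'.comp_le _ _ _)

theorem IsEssentialQB.isDense {A : QBAlg V X} (h : IsEssentialQB A Q'.toQBAlg i) :
    IsDense A.toLVCat Q' i := by
  have hcolim := h.isColimitDense
  obtain ⟨hff, hess⟩ := h
  rw [Q'.toLVCat_toQBAlg] at hff
  have hr := hcolim.nucleus_rres hff
  have hl := hcolim.nucleus_lres hff
  have hid := hess Q (nucleusQBAlg Q' i hr hl) id (isQBHom_id_nucleusQBAlg hr hl) fun xs x => by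
    refine (hff xs x).trans (Eq.trans ?_ (nucleusQBAlg_lhom hr hl _ _).symm)
    change _ = Q'.hom _ (nucleus Q' i (i x))
    rw [nucleus_apply]
    rfl
  refine (isDense_iff Q' i A.toLVCat).2 ⟨hff, fun q t v hv => ?_, hcolim⟩
  exact ((le_hom_nucleus_iff Q' i q t v).2 hv).trans (hid [t] q).ge

end Limit

end QEnr

theorem mainTheorem4 {V : Type v} [CommMonoid V] [CompleteLattice V] [IsQuantale V]
    {X Q : Type u} (A : QEnr.QBAlg V X) (Q' : QEnr.VQuantale V Q) (i : X → Q)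
    (hi : QEnr.IsQBHom A Q'.toQBAlg i) :
    (QEnr.IsDense A.toLVCat Q' i ↔ QEnr.IsEssentialQB A Q'.toQBAlg i) ∧
    (QEnr.IsDense A.toLVCat Q' i ↔ QEnr.IsEssentialLV A.toLVCat Q'.toLVCat i) :=
  ⟨⟨fun h => h.isEssentialLV.isEssentialQB, fun h => h.isDense⟩,
    ⟨fun h => h.isEssentialLV, fun h => h.isEssentialQB.isDense⟩⟩
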